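/- Let $d\ge 0$ and let $F\in C^3(\mathbb R^d)$ be $\mathbb Z^d$-periodic with $F(0)=0$, with set of global minimizers exactly $\mathbb Z^d$, and with $D^2F(0)$ positive definite. Put $h(y,x)=\tfrac12|x-y|^2+F(y)$ and let $\psi$ be the continuous $\mathbb Z^d$-periodic function with $\psi(0)=0$ and $\psi(x)=\min_{y\in\mathbb R^d}\{\psi(y)+h(y,x)\}$ for all $x$. For $\nu>0$ let $$\widetilde K_\nu(y,x)=(4\pi\nu)^{-d/2}\exp\Big(-\tfrac1{2\nu}\big(h(y,x)+\psi(y)-\psi(x)\big)\Big).$$ Let $U\subset\mathbb R^d$ be any $\mathbb Z^d$-periodic open set containing $\bigcup_{x\in\mathbb R^d}\operatorname{argmin}_y\{\psi(y)+h(y,x)\}$, and set $\chi_\nu=1$ on $U$, $\chi_\nu=\nu^{-d/2}$ off $U$, and $V=V_\nu=\psi\chi_\nu^2$. A periodic Markov kernel is a measurable $\pi(y,x)\ge 0$ on $\mathbb R^d\times\mathbb R^d$ with $\int\pi(y,x)\,dy=1$ for every $x$ and $\pi(y+k,x+k)=\pi(y,x)$ for all $k\in\mathbb Z^d$; its Markov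 operator is $(\mathcal P u)(x)=\int\pi(y,x)u(y)\,dy$. There is $\gamma\in(0,1)$ depending only on $F$, and for every such $U$ and every $D>1$ there are $C>1$, $\alpha_0\in(0,1)$, $\nu_1>0$, $R>2C/(1-\gamma)$ and probability densities $(g_\nu)_{0<\nu<\nu_1}$ on $\mathbb R^d$, depending only on $F$, $U$ and $D$, with the following property. Let $\nu_0>0$ and let $\pi_\nu$, $\nu\in(0,\nu_0)$, be periodic Markov kernels, with operators $\mathcal P_\nu$, such that for all $x,y\in\mathbb R^d$ $$\frac1{D\chi_\nu(x)}\le\frac{\pi_\nu(y,x)}{\widetilde K_\nu(y,x)}\le D\chi_\nu(y).$$ Then for all $0<\nu<\min(\nu_0,\nu_1)$: 1. $V\ge 0$ is bounded, $\pi_\nu(\cdot,x)V$ is integrable for every $x$, and $(\mathcal P_\nu V)(x)\le\gamma V(x)+C\nu$ for every $x\in\mathbb R^d$. 2. For all $y\in\mathbb R^d$, $\ \inf\{\pi_\nu(y,x): x\in[-\tfrac12,\tfrac12)^d,\ V(x)\le R\nu\}\ge\alpha_0\,g_\nu(y)$. Equivalently, by periodicity, whenever $V(x)\le R\nu$ and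 $x\in k+[-\tfrac12,\tfrac12)^d$ with $k\in\mathbb Z^d$, one has $\pi_\nu(y,x)\ge\alpha_0\,g_\nu(y-k)$ for all $y$. -/

import Mathlib

open MeasureTheory

namespace KickedHJ

noncomputable section

/-- The integer vector `k`, seen as a point of Euclidean space. -/
def intVec {d : ℕ} (k : Fin d → ℤ) : EuclideanSpace ℝ (Fin d) :=
  WithLp.toLp 2 fun i => (k i : ℝ)

/-- `ℤ^d`-periodic functions on `ℝ^d`. -/
def IsPeriodic {d : ℕ} (f : EuclideanSpace ℝ (Fin d) → ℝ) : Prop :=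
  ∀ (k : Fin d → ℤ) (x : EuclideanSpace ℝ (Fin d)), f (x + intVec k) = f x

/-- The assumption on the kick potential: a periodic `C^3` function with `F 0 = 0`, whose set of
global minimizers is exactly `ℤ^d` (that is, the single point `0` of the torus), and whose second
derivative at `0` is positive definite. -/
structure IsKickPotential {d : ℕ} (F : EuclideanSpace ℝ (Fin d) → ℝ) : Prop where
  contDiff : ContDiff ℝ 3 F
  periodic : IsPeriodic F
  map_zero : F 0 = 0
  argmin : ∀ x, (∀ y, F x ≤ F y) ↔ ∃ k : Fin d → ℤ, x = intVec k
  posDef : ∀ v : EuclideanSpace ℝ (Fin d), v ≠ 0 → 0 < fderiv ℝ (fderiv ℝ F) 0 v v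

/-- The generating function `h(y, x) = |x - y|² / 2 + F(y)`. -/
def genFun {d : ℕ} (F : EuclideanSpace ℝ (Fin d) → ℝ) (y x : EuclideanSpace ℝ (Fin d)) : ℝ :=
  ‖x - y‖ ^ 2 / 2 + F y

/-- `ψ` is the stationary solution of the inviscid equation: a continuous periodic function,
normalized by `ψ 0 = 0`, fixed by the Lax-Oleinik operator, i.e.
`ψ(x) = min_y (ψ(y) + h(y, x))` for every `x`. -/
structure IsWeakKAM {d : ℕ} (F ψ : EuclideanSpace ℝ (Fin d) → ℝ) : Prop where
  continuous : Continuous ψ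
  periodic : IsPeriodic ψ
  map_zero : ψ 0 = 0
  fixed : ∀ x, IsLeast (Set.range fun y => ψ y + genFun F y x) (ψ x)

/-- The union over `x` of the sets `argmin_y (ψ(y) + h(y, x))`. -/
def backwardSet {d : ℕ} (F ψ : EuclideanSpace ℝ (Fin d) → ℝ) :
    Set (EuclideanSpace ℝ (Fin d)) :=
  {y | ∃ x, ∀ z, ψ y + genFun F y x ≤ ψ z + genFun F z x}

/-- The kernel `K_ν(y, x) = (4πν)^{-d/2} exp(-h(y, x) / (2ν))`. -/
def kernelK {d : ℕ} (F : EuclideanSpace ℝ (Fin d) → ℝ) (ν : ℝ)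
    (y x : EuclideanSpace ℝ (Fin d)) : ℝ :=
  (4 * Real.pi * ν) ^ (-((d : ℝ) / 2)) * Real.exp (-(genFun F y x / (2 * ν)))

/-- The conjugated kernel `exp(ψ(x) / (2ν)) K_ν(y, x) exp(-ψ(y) / (2ν))`. -/
def kernelConj {d : ℕ} (F ψ : EuclideanSpace ℝ (Fin d) → ℝ) (ν : ℝ)
    (y x : EuclideanSpace ℝ (Fin d)) : ℝ :=
  Real.exp (ψ x / (2 * ν)) * kernelK F ν y x * Real.exp (-(ψ y / (2 * ν)))

open Classical in
/-- `χ_ν = 1` on `U` and `χ_ν = ν^{-d/2}` off `U`. -/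
def chi {d : ℕ} (U : Set (EuclideanSpace ℝ (Fin d))) (ν : ℝ)
    (x : EuclideanSpace ℝ (Fin d)) : ℝ :=
  if x ∈ U then 1 else ν ^ (-((d : ℝ) / 2))

/-- The Lyapunov function `V = ψ χ_ν²`. -/
def lyapunov {d : ℕ} (ψ : EuclideanSpace ℝ (Fin d) → ℝ) (U : Set (EuclideanSpace ℝ (Fin d)))
    (ν : ℝ) (x : EuclideanSpace ℝ (Fin d)) : ℝ :=
  ψ x * chi U ν x ^ 2

/-- A periodic Markov kernel `p(y, x)`: `x` is the current state, `p(·, x)` the density of the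
next one, and `p` is invariant under simultaneous integer translations of both variables. -/
structure IsPeriodicMarkovKernel {d : ℕ}
    (p : EuclideanSpace ℝ (Fin d) → EuclideanSpace ℝ (Fin d) → ℝ) : Prop where
  measurable : Measurable (Function.uncurry p)
  nonneg : ∀ y x, 0 ≤ p y x
  periodic : ∀ (k : Fin d → ℤ) (y x : EuclideanSpace ℝ (Fin d)),
    p (y + intVec k) (x + intVec k) = p y x
  integrable : ∀ x, Integrable fun y => p y x
  integral_eq_one : ∀ x, ∫ y, p y x = 1

/-- The Markov operator `(P u)(x) = ∫ p(y, x) u(y) dy`. -/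
def markovOp {d : ℕ} (p : EuclideanSpace ℝ (Fin d) → EuclideanSpace ℝ (Fin d) → ℝ)
    (u : EuclideanSpace ℝ (Fin d) → ℝ) (x : EuclideanSpace ℝ (Fin d)) : ℝ :=
  ∫ y, p y x * u y

/-- Probability densities on `ℝ^d`. -/
structure IsProbDensity {d : ℕ} (g : EuclideanSpace ℝ (Fin d) → ℝ) : Prop where
  measurable : Measurable g
  nonneg : ∀ y, 0 ≤ g y
  integrable : Integrable g
  integral_eq_one : ∫ y, g y = 1

/-- The fundamental domain `[-1/2, 1/2)^d` of `ℝ^d / ℤ^d`. -/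
def unitCell (d : ℕ) : Set (EuclideanSpace ℝ (Fin d)) :=
  {x | ∀ i, -(1 / 2 : ℝ) ≤ x i ∧ x i < 1 / 2}

end

end KickedHJ

open KickedHJ

/-! ### Lattice geometry and a calculus estimate along rays. -/

namespace KickedHJ

open Filter Topology

variable {d : ℕ}

/-! Write e(y, x) = ψ(y) + h(y, x) - ψ(x) ≥ 0; the conjugated kernel is a normalized exp(-e / 2ν).
Nondegeneracy at 0 and compactness give F ≥ c dist(·, ℤ^d)² with c ≤ 1/2. Since ψ ≤ dist² / 2, this
yields h(y, x) ≥ c ψ(x), so ψ(y) ≤ (1 - c) ψ(x) + e.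

Drift: if e ≤ (c/2) ψ(x), then ψ contracts by γ = 1 - c/2. Otherwise e controls |x - y|², and e
exp(-e / 2ν) is at most ν times a Gaussian factor, which integrates to O(ν) (`mul_le_add_gaussian`).
Off U, e is bounded below by a positive constant (`exists_le_excess`), and the exponential gain
absorbs all powers of χ_ν (`exists_mul_lyapunov_le`).

Minorization: V(x) ≤ Rν puts x within O(√ν) of a lattice point k, hence in U for small ν, where χ_ν
= 1. Then e(y, x) ≤ O(ν) + O(|y - k|²), so the kernel dominates a Gaussian of width √ν whose mass
does not depend on ν (`exists_gaussian_le`). -/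

/-- The closed cube `[-1/2, 1/2]^d`. -/
def closedCell (d : ℕ) : Set (EuclideanSpace ℝ (Fin d)) :=
  {x | ∀ i, |x i| ≤ 1 / 2}

theorem unitCell_subset_closedCell : unitCell d ⊆ closedCell d := fun _ hx i =>
  abs_le.2 ⟨(hx i).1, (hx i).2.le⟩

theorem isCompact_closedCell : IsCompact (closedCell d) := by
  have hclosed : IsClosed (closedCell d) := by
    simp only [closedCell, Set.ofPred_forall]
    exact isClosed_iInter fun i => isClosed_le (by fun_prop) continuous_const
  refine (isCompact_closedBall (0 : EuclideanSpace ℝ (Fin d)) (d + 1)).of_isClosed_subset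
    hclosed fun x hx => ?_
  rw [mem_closedBall_zero_iff]
  refine abs_le_of_sq_le_sq' ?_ (by positivity) |>.2
  calc ‖x‖ ^ 2 = ∑ i, ‖x i‖ ^ 2 := EuclideanSpace.norm_sq_eq x
    _ ≤ ∑ _i : Fin d, (1 : ℝ) := Finset.sum_le_sum fun i _ => by
        have := hx i
        rw [Real.norm_eq_abs]
        nlinarith [abs_nonneg (x i)]
    _ = d := by simp
    _ ≤ (d + 1 : ℝ) ^ 2 := by nlinarith [(Nat.cast_nonneg d : (0 : ℝ) ≤ d)]

theorem exists_sub_intVec_mem_closedCell (x : EuclideanSpace ℝ (Fin d)) :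
    ∃ k, x - intVec k ∈ closedCell d :=
  ⟨fun i => round (x i), fun i => by simpa [intVec] using abs_sub_round (x i)⟩

theorem norm_le_norm_sub_intVec {x : EuclideanSpace ℝ (Fin d)} (hx : x ∈ closedCell d)
    (k : Fin d → ℤ) : ‖x‖ ≤ ‖x - intVec k‖ := by
  rw [EuclideanSpace.norm_eq, EuclideanSpace.norm_eq]
  refine Real.sqrt_le_sqrt (Finset.sum_le_sum fun i _ => ?_)
  refine pow_le_pow_left₀ (norm_nonneg _) ?_ 2
  have hxi : |x i| ≤ 1 / 2 := hx i
  change |x i| ≤ |x i - (k i : ℝ)|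
  rcases eq_or_ne (k i) 0 with h | h
  · simp [h]
  · have h1 : (1 : ℝ) ≤ |(k i : ℝ)| := by exact_mod_cast Int.one_le_abs h
    have h2 := abs_sub_abs_le_abs_sub (k i : ℝ) (x i)
    rw [abs_sub_comm] at h2
    linarith

theorem IsPeriodic.sub {f : EuclideanSpace ℝ (Fin d) → ℝ} (hf : IsPeriodic f)
    (k : Fin d → ℤ) (x : EuclideanSpace ℝ (Fin d)) : f (x - intVec k) = f x := by
  rw [← hf k, sub_add_cancel]

theorem IsPeriodic.exists_le {f : EuclideanSpace ℝ (Fin d) → ℝ} (hf : IsPeriodic f)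
    (hc : Continuous f) : ∃ M, 0 ≤ M ∧ ∀ x, f x ≤ M := by
  obtain ⟨M, hM⟩ := isCompact_closedCell.bddAbove_image hc.continuousOn
  refine ⟨max M 0, le_max_right _ _, fun x => ?_⟩
  obtain ⟨k, hk⟩ := exists_sub_intVec_mem_closedCell x
  rw [← hf.sub k x]
  exact le_max_of_le_left (hM ⟨_, hk, rfl⟩)

/-- The function t ↦ f(ty) - c|y|²t² has nonnegative derivative on (0, 1). -/
theorem add_mul_norm_sq_le_of_fderiv {E : Type*} [NormedAddCommGroup E] [NormedSpace ℝ E]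
    {f : E → ℝ} (hf : Differentiable ℝ f) {c r : ℝ}
    (h : ∀ y, ‖y‖ < r → 2 * c * ‖y‖ ^ 2 ≤ fderiv ℝ f y y) {y : E} (hy : ‖y‖ < r) :
    f 0 + c * ‖y‖ ^ 2 ≤ f y := by
  have hder : ∀ t : ℝ, HasDerivAt (fun t : ℝ => f (t • y) - c * ‖y‖ ^ 2 * t ^ 2)
      (fderiv ℝ f (t • y) y - c * ‖y‖ ^ 2 * (2 * t)) t := fun t => by
    have h1 : HasDerivAt (fun t : ℝ => t • y) y t := by
      simpa using (hasDerivAt_id t).smul_const y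
    have h2 : HasDerivAt (fun t : ℝ => f (t • y)) (fderiv ℝ f (t • y) y) t :=
      (hf (t • y)).hasFDerivAt.comp_hasDerivAt t h1
    have h3 := (hasDerivAt_pow 2 t).const_mul (c * ‖y‖ ^ 2)
    convert! h2.sub h3 using 1
    simp
  have hmono : MonotoneOn (fun t : ℝ => f (t • y) - c * ‖y‖ ^ 2 * t ^ 2) (Set.Icc 0 1) := by
    refine monotoneOn_of_deriv_nonneg (convex_Icc 0 1)
      (fun t _ => (hder t).continuousAt.continuousWithinAt)
      (fun t _ => (hder t).differentiableAt.differentiableWithinAt) fun t ht => ?_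
    rw [interior_Icc] at ht
    rw [(hder t).deriv]
    have hty : ‖t • y‖ = t * ‖y‖ := by rw [norm_smul, Real.norm_of_nonneg ht.1.le]
    have h1 := h (t • y) (by rw [hty]; nlinarith [norm_nonneg y, ht.2])
    rw [hty, map_smul, smul_eq_mul] at h1
    refine nonneg_of_mul_nonneg_right (a := t) ?_ ht.1
    nlinarith
  have := hmono (Set.left_mem_Icc.2 zero_le_one) (Set.right_mem_Icc.2 zero_le_one) zero_le_one
  simp only [zero_smul, one_smul] at this
  linarith

/-! ### Quadratic bounds on the potential. -/

namespace IsKickPotential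

variable {F : EuclideanSpace ℝ (Fin d) → ℝ} (hF : IsKickPotential F)
include hF

theorem nonneg (x : EuclideanSpace ℝ (Fin d)) : 0 ≤ F x := by
  have h := (hF.argmin 0).2 ⟨0, by ext; simp [intVec]⟩ x
  rwa [hF.map_zero] at h

theorem exists_intVec_of_eq_zero {x : EuclideanSpace ℝ (Fin d)} (hx : F x = 0) :
    ∃ k, x = intVec k :=
  (hF.argmin x).1 fun y => hx ▸ hF.nonneg y

theorem eq_zero_of_mem_closedCell {x : EuclideanSpace ℝ (Fin d)} (hx : x ∈ closedCell d)
    (h : F x = 0) : x = 0 := by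
  obtain ⟨k, hk⟩ := hF.exists_intVec_of_eq_zero h
  have := norm_le_norm_sub_intVec hx k
  rwa [← hk, sub_self, norm_zero, norm_le_zero_iff] at this

theorem exists_local_bounds : ∃ c C r : ℝ, 0 < c ∧ 0 < r ∧
    ∀ y, ‖y‖ < r → c * ‖y‖ ^ 2 ≤ F y ∧ F y ≤ C * ‖y‖ ^ 2 := by
  have hdiff : Differentiable ℝ F := hF.contDiff.differentiable (by norm_num)
  set B := fderiv ℝ (fderiv ℝ F) 0 with hB
  have hd : HasFDerivAt (fderiv ℝ F) B 0 :=
    ((hF.contDiff.fderiv_right (m := 1) (by norm_num)).differentiable (by norm_num) 0).hasFDerivAt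
  have h0 : fderiv ℝ F 0 = 0 := IsLocalMin.fderiv_eq_zero
    (Filter.Eventually.of_forall fun y => by rw [hF.map_zero]; exact hF.nonneg y)
  obtain ⟨l, hl, hlB⟩ : ∃ l, 0 < l ∧ ∀ v, l * ‖v‖ ^ 2 ≤ B v v := by
    obtain ⟨l, hl, h⟩ := (isCompact_sphere (0 : EuclideanSpace ℝ (Fin d)) 1).exists_forall_le'
      (f := fun v => B v v) (a := 0) (by fun_prop)
      fun v hv => hF.posDef v (ne_zero_of_mem_unit_sphere ⟨v, hv⟩)
    refine ⟨l, hl, fun v => ?_⟩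
    rcases eq_or_ne v 0 with rfl | hv
    · simp
    have hv' : 0 < ‖v‖ := norm_pos_iff.2 hv
    have := h (‖v‖⁻¹ • v) (by simp [norm_smul, hv'.ne'])
    simp only [map_smul, smul_apply, smul_eq_mul] at this
    calc l * ‖v‖ ^ 2 ≤ (‖v‖⁻¹ * (‖v‖⁻¹ * B v v)) * ‖v‖ ^ 2 := by gcongr
      _ = B v v := by field_simp
  have hlo := hd.isLittleO.def (half_pos hl)
  obtain ⟨r, hr, hball⟩ := Metric.eventually_nhds_iff.1 hlo
  have key : ∀ y, ‖y‖ < r → |fderiv ℝ F y y - B y y| ≤ l / 2 * ‖y‖ ^ 2 := fun y hy => by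
    have h1 := hball (y := y) (by simpa using hy)
    simp only [h0, sub_zero] at h1
    calc |fderiv ℝ F y y - B y y| = ‖(fderiv ℝ F y - B y) y‖ := by simp
      _ ≤ ‖fderiv ℝ F y - B y‖ * ‖y‖ := ContinuousLinearMap.le_opNorm _ _
      _ ≤ l / 2 * ‖y‖ * ‖y‖ := by gcongr
      _ = l / 2 * ‖y‖ ^ 2 := by ring
  -- The radial derivative lies between (l/2)|y|² and (‖B‖ + l/2)|y|²; integration along rays halves
  -- these constants. The upper bound is the lower bound for -F.
  refine ⟨l / 4, (‖B‖ + l / 2) / 2, r, by positivity, hr, fun y hy => ⟨?_, ?_⟩⟩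
  · have := add_mul_norm_sq_le_of_fderiv hdiff (c := l / 4) (r := r) (fun z hz => by
      have := (abs_le.1 (key z hz)).1
      linarith [hlB z]) hy
    rwa [hF.map_zero, zero_add] at this
  · have := add_mul_norm_sq_le_of_fderiv hdiff.neg (c := -((‖B‖ + l / 2) / 2)) (r := r)
      (fun z hz => by
        have h1 := (abs_le.1 (key z hz)).2
        have h2 : B z z ≤ ‖B‖ * ‖z‖ * ‖z‖ := (le_abs_self _).trans (B.le_opNorm₂ z z)
        rw [fderiv_neg, neg_apply]
        nlinarith) hy
    simp only [Pi.neg_apply, hF.map_zero] at this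
    linarith

theorem exists_le_mul_norm_sq : ∃ C, 0 ≤ C ∧ ∀ y, F y ≤ C * ‖y‖ ^ 2 := by
  obtain ⟨c, C, r, hc, hr, h⟩ := hF.exists_local_bounds
  obtain ⟨M, hM0, hM⟩ := hF.periodic.exists_le hF.contDiff.continuous
  refine ⟨max C (M / r ^ 2), le_max_of_le_right (by positivity), fun y => ?_⟩
  rcases lt_or_ge ‖y‖ r with hy | hy
  · exact (h y hy).2.trans (by gcongr; exact le_max_left _ _)
  · calc F y ≤ M := hM y
      _ = M / r ^ 2 * r ^ 2 := by field_simp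
      _ ≤ max C (M / r ^ 2) * ‖y‖ ^ 2 := by gcongr; exact le_max_right _ _

theorem exists_mul_norm_sq_le : ∃ c, 0 < c ∧ c ≤ 1 / 2 ∧
    ∀ y, ∃ k, c * ‖y - intVec k‖ ^ 2 ≤ F y := by
  obtain ⟨c, C, r, hc, hr, h⟩ := hF.exists_local_bounds
  obtain ⟨m, hm, hmF⟩ := (isCompact_closedCell.diff
    (Metric.isOpen_ball (x := (0 : EuclideanSpace ℝ (Fin d))) (ε := r))).exists_forall_le'
    (a := 0) hF.contDiff.continuous.continuousOn fun y hy =>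
      (hF.nonneg y).lt_of_ne' fun h0 => hy.2 (by
        rw [hF.eq_zero_of_mem_closedCell hy.1 h0]; exact Metric.mem_ball_self hr)
  obtain ⟨M, hM⟩ := isCompact_closedCell (d := d).bddAbove_image
    (f := fun y => ‖y‖ ^ 2) (by fun_prop)
  have hM1 : 0 < max M 1 := by positivity
  -- The cap 1/2 lets the kinetic term be used in `exists_le_genFun`; `max M 1` keeps the
  -- denominator positive.
  refine ⟨min (1 / 2) (min c (m / max M 1)), by positivity, min_le_left _ _, fun y => ?_⟩
  obtain ⟨k, hk⟩ := exists_sub_intVec_mem_closedCell y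
  refine ⟨k, ?_⟩
  rw [← hF.periodic.sub k y]
  rcases lt_or_ge ‖y - intVec k‖ r with hy | hy
  · refine le_trans ?_ (h _ hy).1
    gcongr
    exact (min_le_right _ _).trans (min_le_left _ _)
  · have h1 : ‖y - intVec k‖ ^ 2 ≤ max M 1 := le_max_of_le_left (hM ⟨_, hk, rfl⟩)
    calc _ ≤ m / max M 1 * max M 1 := by
          gcongr
          exact (min_le_right _ _).trans (min_le_right _ _)
      _ = m := by field_simp
      _ ≤ _ := hmF _ ⟨hk, by simpa using hy⟩

end IsKickPotential

end KickedHJ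

/-! ### The conjugated kernel, Gaussians and the weight χ_ν. -/

namespace KickedHJ

open Filter Topology

variable {d : ℕ}

/-- The excess `ψ(y) + h(y, x) - ψ(x)` of the action over its minimal value. -/
noncomputable def excess (F ψ : EuclideanSpace ℝ (Fin d) → ℝ) (y x : EuclideanSpace ℝ (Fin d)) : ℝ :=
  ψ y + genFun F y x - ψ x

/-- The function `(4πν)^{-d/2} exp(-b |z|² / ν)`. -/
noncomputable def gaussian (b ν : ℝ) (z : EuclideanSpace ℝ (Fin d)) : ℝ :=
  (4 * Real.pi * ν) ^ (-((d : ℝ) / 2)) * Real.exp (-(b / ν) * ‖z‖ ^ 2)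

theorem kernelConj_eq (F ψ : EuclideanSpace ℝ (Fin d) → ℝ) (ν : ℝ)
    (y x : EuclideanSpace ℝ (Fin d)) : kernelConj F ψ ν y x =
      (4 * Real.pi * ν) ^ (-((d : ℝ) / 2)) * Real.exp (-(excess F ψ y x / (2 * ν))) := by
  rw [kernelConj, kernelK, mul_left_comm, mul_assoc, mul_assoc, ← Real.exp_add, ← Real.exp_add]
  congr 2
  rw [excess]
  ring

theorem kernelConj_pos (F ψ : EuclideanSpace ℝ (Fin d) → ℝ) {ν : ℝ} (hν : 0 < ν)
    (y x : EuclideanSpace ℝ (Fin d)) : 0 < kernelConj F ψ ν y x := by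
  rw [kernelConj_eq]
  positivity

theorem gaussian_nonneg {b ν : ℝ} (hν : 0 < ν) (z : EuclideanSpace ℝ (Fin d)) :
    0 ≤ gaussian b ν z := by
  unfold gaussian
  positivity

/-- The mass is independent of ν, which makes the final constants uniform in ν. -/
theorem integral_gaussian {b ν : ℝ} (hb : 0 < b) (hν : 0 < ν) :
    ∫ z : EuclideanSpace ℝ (Fin d), gaussian b ν z = (4 * b) ^ (-((d : ℝ) / 2)) := by
  unfold gaussian
  rw [integral_const_mul, GaussianFourier.integral_rexp_neg_mul_sq_norm (by positivity),
    finrank_euclideanSpace_fin, Real.rpow_neg (by positivity), Real.rpow_neg (by positivity),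
    ← Real.inv_rpow (by positivity), ← Real.mul_rpow (by positivity) (by positivity),
    ← Real.inv_rpow (by positivity)]
  congr 1
  field_simp

theorem integrable_gaussian {b ν : ℝ} (hb : 0 < b) (hν : 0 < ν) :
    Integrable (gaussian b ν : EuclideanSpace ℝ (Fin d) → ℝ) :=
  Integrable.of_integral_ne_zero (by rw [integral_gaussian hb hν]; positivity)

theorem measurable_gaussian (b ν : ℝ) :
    Measurable (gaussian b ν : EuclideanSpace ℝ (Fin d) → ℝ) := by
  unfold gaussian
  fun_prop

theorem kernelConj_le_gaussian {F ψ : EuclideanSpace ℝ (Fin d) → ℝ} {ν b e : ℝ} (hν : 0 < ν)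
    {y x : EuclideanSpace ℝ (Fin d)} (h : e + b * ‖y - x‖ ^ 2 ≤ excess F ψ y x) :
    kernelConj F ψ ν y x ≤ Real.exp (-(e / (2 * ν))) * gaussian (b / 2) ν (y - x) := by
  rw [kernelConj_eq, gaussian, mul_left_comm, ← Real.exp_add]
  gcongr
  rw [show -(e / (2 * ν)) + -(b / 2 / ν) * ‖y - x‖ ^ 2
    = -((e + b * ‖y - x‖ ^ 2) / (2 * ν)) by field_simp; ring]
  gcongr

theorem one_le_chi (U : Set (EuclideanSpace ℝ (Fin d))) {ν : ℝ} (hν : 0 < ν) (hν1 : ν ≤ 1)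
    (x : EuclideanSpace ℝ (Fin d)) : 1 ≤ chi U ν x := by
  unfold chi
  split_ifs
  · exact le_rfl
  · exact Real.one_le_rpow_of_pos_of_le_one_of_nonpos hν hν1 (neg_nonpos.2 (by positivity))

theorem chi_le (U : Set (EuclideanSpace ℝ (Fin d))) {ν : ℝ} (hν : 0 < ν) (hν1 : ν ≤ 1)
    (x : EuclideanSpace ℝ (Fin d)) : chi U ν x ≤ ν ^ (-((d : ℝ) / 2)) := by
  unfold chi
  split_ifs
  · exact Real.one_le_rpow_of_pos_of_le_one_of_nonpos hν hν1 (neg_nonpos.2 (by positivity))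
  · exact le_rfl

theorem measurable_chi {U : Set (EuclideanSpace ℝ (Fin d))} (hU : IsOpen U) (ν : ℝ) :
    Measurable (chi U ν) :=
  Measurable.ite hU.measurableSet measurable_const measurable_const

/-- Used with s = d/2: one power of χ_ν comes from the kernel bound and two from V. -/
theorem eventually_chi_pow_mul_exp_le (s : ℝ) {a : ℝ} (ha : 0 < a) :
    ∃ ν₁, 0 < ν₁ ∧ ∀ ν, 0 < ν → ν < ν₁ → (ν ^ (-s)) ^ 3 * Real.exp (-(a / ν)) ≤ ν := by
  have h := (tendsto_rpow_mul_exp_neg_mul_atTop_nhds_zero (3 * s + 1) a ha).comp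
    tendsto_inv_nhdsGT_zero
  have h1 := h.eventually (Iic_mem_nhds (one_pos : (0 : ℝ) < 1))
  obtain ⟨ν₁, hν₁, H⟩ := mem_nhdsGT_iff_exists_Ioo_subset.1 h1
  refine ⟨ν₁, hν₁, fun ν h0 h2 => ?_⟩
  have h3 : ν⁻¹ ^ (3 * s + 1) * Real.exp (-a * ν⁻¹) ≤ 1 := H ⟨h0, h2⟩
  have h4 : ν⁻¹ ^ (3 * s + 1) = (ν ^ (-s)) ^ 3 * ν⁻¹ := by
    rw [Real.rpow_add (by positivity), Real.rpow_one, Real.rpow_neg h0.le,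
      ← Real.inv_rpow h0.le, ← Real.rpow_natCast, ← Real.rpow_mul (by positivity)]
    norm_num [mul_comm]
  calc (ν ^ (-s)) ^ 3 * Real.exp (-(a / ν))
      = ν * (ν⁻¹ ^ (3 * s + 1) * Real.exp (-a * ν⁻¹)) := by
        rw [h4, neg_mul, ← div_eq_mul_inv]
        field_simp
    _ ≤ ν * 1 := by gcongr
    _ = ν := mul_one ν

/-! ### Bounds on ψ and the excess. -/

namespace IsWeakKAM

variable {F ψ : EuclideanSpace ℝ (Fin d) → ℝ} (hψ : IsWeakKAM F ψ)
include hψ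

theorem excess_nonneg (y x : EuclideanSpace ℝ (Fin d)) : 0 ≤ excess F ψ y x :=
  sub_nonneg.2 ((hψ.fixed x).2 ⟨y, rfl⟩)

theorem apply_intVec (k : Fin d → ℤ) : ψ (intVec k) = 0 := by
  rw [← zero_add (intVec k), hψ.periodic, hψ.map_zero]

/-- At a minimum point z of ψ, let y attain the Lax-Oleinik minimum. Then ψ(y) ≥ ψ(z) forces |z - y|
= 0 and F(y) = 0, so z is a lattice point and ψ(z) = 0. -/
theorem nonneg (hF : IsKickPotential F) (x : EuclideanSpace ℝ (Fin d)) : 0 ≤ ψ x := by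
  obtain ⟨z, -, hz⟩ := isCompact_closedCell.exists_isMinOn
    ⟨0, fun i => by simp⟩ (hψ.continuous.continuousOn (s := closedCell d))
  have hmin : ∀ y, ψ z ≤ ψ y := fun y => by
    obtain ⟨k, hk⟩ := exists_sub_intVec_mem_closedCell y
    rw [← hψ.periodic.sub k y]
    exact hz hk
  obtain ⟨y, hy⟩ := (hψ.fixed z).1
  have h1 := hmin y
  have h2 := hF.nonneg y
  have h3 := sq_nonneg ‖z - y‖
  simp only [genFun] at hy
  have h4 : ‖z - y‖ ^ 2 = 0 := by linarith
  have h5 : z = y := by simpa [sub_eq_zero] using h4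
  obtain ⟨k, rfl⟩ := hF.exists_intVec_of_eq_zero (x := y) (by linarith)
  rw [← hψ.apply_intVec k, ← h5]
  exact hmin x

theorem le_half_norm_sq (hF : IsKickPotential F) (k : Fin d → ℤ)
    (x : EuclideanSpace ℝ (Fin d)) : ψ x ≤ ‖x - intVec k‖ ^ 2 / 2 := by
  have h := hψ.excess_nonneg (intVec k) x
  have hFk : F (intVec k) = 0 := by
    rw [← zero_add (intVec k), hF.periodic, hF.map_zero]
  rw [excess, genFun, hψ.apply_intVec, hFk] at h
  linarith

theorem zero_mem_backwardSet (hF : IsKickPotential F) : 0 ∈ backwardSet F ψ := by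
  refine ⟨0, fun z => ?_⟩
  have h1 := hψ.nonneg hF z
  have h2 := hF.nonneg z
  simp only [genFun, hψ.map_zero, hF.map_zero, sub_self, norm_zero]
  nlinarith [sq_nonneg ‖(0 : EuclideanSpace ℝ (Fin d)) - z‖]

/-- The excess is bounded below away from a neighbourhood of the backward set. -/
theorem exists_le_excess (hF : IsKickPotential F) {U : Set (EuclideanSpace ℝ (Fin d))}
    (hU : IsOpen U) (hper : ∀ (k : Fin d → ℤ) (x : EuclideanSpace ℝ (Fin d)),
      x + intVec k ∈ U ↔ x ∈ U) (hsub : backwardSet F ψ ⊆ U) :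
    ∃ a, 0 < a ∧ ∀ y ∉ U, ∀ x, a ≤ excess F ψ y x := by
  obtain ⟨M, hM0, hM⟩ := hψ.periodic.exists_le hψ.continuous
  have hcont : Continuous fun q : EuclideanSpace ℝ (Fin d) × EuclideanSpace ℝ (Fin d) =>
      excess F ψ q.1 (q.1 + q.2) := by
    have := hψ.continuous
    have := hF.contDiff.continuous
    unfold excess genFun
    fun_prop
  -- The coordinates are (y, x - y). Periodicity makes y range over a compact set, and long
  -- displacements are left to the kinetic term. Zero excess would put y in the backward set.
  obtain ⟨a, ha, h⟩ := ((isCompact_closedCell.diff hU).prod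
    (isCompact_closedBall (0 : EuclideanSpace ℝ (Fin d)) (2 * (M + 1)))).exists_forall_le' (a := 0)
    hcont.continuousOn fun q hq => (hψ.excess_nonneg _ _).lt_of_ne' fun h0 =>
      hq.1.2 (hsub ⟨q.1 + q.2, fun z => by
        have := hψ.excess_nonneg z (q.1 + q.2)
        simp only [excess] at this h0
        linarith⟩)
  refine ⟨min a 1, by positivity, fun y hy x => ?_⟩
  rcases le_or_gt ‖x - y‖ (2 * (M + 1)) with hxy | hxy
  · obtain ⟨k, hk⟩ := exists_sub_intVec_mem_closedCell y
    have hy' : y - intVec k ∉ U := fun hm => hy (by simpa using (hper k _).2 hm)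
    have := h (y - intVec k, x - y) ⟨⟨hk, hy'⟩, by simpa using hxy⟩
    have heq : excess F ψ (y - intVec k) (y - intVec k + (x - y)) = excess F ψ y x := by
      rw [show y - intVec k + (x - y) = x - intVec k by abel]
      simp only [excess, genFun, hψ.periodic.sub k, hF.periodic.sub k, sub_sub_sub_cancel_right]
    rw [heq] at this
    exact min_le_of_left_le this
  · refine min_le_of_right_le ?_
    have h1 := hψ.nonneg hF y
    have h2 := hF.nonneg y
    have h3 := hM x
    simp only [excess, genFun]
    nlinarith

section Coercive

variable {c : ℝ} (hc : 0 < c) (hc2 : c ≤ 1 / 2)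
  (hcF : ∀ y, ∃ k, c * ‖y - intVec k‖ ^ 2 ≤ F y)
include hc hc2 hcF

-- From |x - k|² ≤ 2|x - y|² + 2|y - k|²: the kinetic term pays for the first part as c ≤ 1/2, and
-- F(y) for the second.
omit hψ in
theorem exists_le_genFun (y x : EuclideanSpace ℝ (Fin d)) :
    ∃ k, c / 2 * ‖x - intVec k‖ ^ 2 ≤ genFun F y x := by
  obtain ⟨k, hk⟩ := hcF y
  refine ⟨k, ?_⟩
  have h1 := norm_add_le (x - y) (y - intVec k)
  rw [sub_add_sub_cancel] at h1
  have h2 : ‖x - intVec k‖ ^ 2 ≤ 2 * ‖x - y‖ ^ 2 + 2 * ‖y - intVec k‖ ^ 2 := by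
    nlinarith [norm_nonneg (x - intVec k), sq_nonneg (‖x - y‖ - ‖y - intVec k‖)]
  rw [genFun]
  nlinarith [sq_nonneg ‖x - y‖]

theorem mul_le_genFun (hF : IsKickPotential F) (y x : EuclideanSpace ℝ (Fin d)) :
    c * ψ x ≤ genFun F y x := by
  obtain ⟨k, hk⟩ := exists_le_genFun hc hc2 hcF y x
  nlinarith [hψ.le_half_norm_sq hF k x]

theorem mul_norm_sq_le (hF : IsKickPotential F) {x : EuclideanSpace ℝ (Fin d)}
    (hx : x ∈ closedCell d) : c / 2 * ‖x‖ ^ 2 ≤ ψ x := by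
  obtain ⟨y, hy⟩ := (hψ.fixed x).1
  obtain ⟨k, hk⟩ := exists_le_genFun hc hc2 hcF y x
  have h1 : c / 2 * ‖x‖ ^ 2 ≤ c / 2 * ‖x - intVec k‖ ^ 2 := by
    gcongr
    exact norm_le_norm_sub_intVec hx k
  have h2 := hψ.nonneg hF y
  simp only at hy
  linarith

/-- Along the conjugated kernel `ψ` contracts, up to an error of order `ν`. -/
theorem mul_le_add_gaussian (hF : IsKickPotential F) {ν D q : ℝ} (hν : 0 < ν) (hD : 0 ≤ D)
    (y x : EuclideanSpace ℝ (Fin d)) (hq : 0 ≤ q) (hqD : q ≤ D * kernelConj F ψ ν y x) :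
    q * ψ y ≤ (1 - c / 2) * ψ x * q + 4 * D * ν * gaussian (c / 24) ν (y - x) := by
  have hh := hψ.mul_le_genFun hc hc2 hcF hF y x
  have hy : ψ y = ψ x - genFun F y x + excess F ψ y x := by rw [excess]; ring
  have hG := gaussian_nonneg (b := c / 24) hν (y - x)
  set e := excess F ψ y x with he
  rcases le_or_gt e (c / 2 * ψ x) with h | h
  · have h1 : ψ y ≤ (1 - c / 2) * ψ x := by linarith
    nlinarith [mul_le_mul_of_nonneg_left h1 hq, mul_nonneg (mul_nonneg hD hν.le) hG]
  · have h0 := hψ.nonneg hF x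
    have he0 : 0 ≤ e := hψ.excess_nonneg y x
    have h1 : ψ y ≤ (1 - c / 2) * ψ x + e := by nlinarith
    -- Here ψ(x) < 2e/c, so |x - y|²/2 ≤ (1 + 2/c) e.
    have h2 : c / 6 * ‖y - x‖ ^ 2 ≤ e := by
      have h3 := hψ.nonneg hF y
      have h4 := hF.nonneg y
      have h5 : ‖x - y‖ ^ 2 / 2 ≤ e + ψ x := by
        rw [he, excess, genFun]
        linarith
      rw [norm_sub_rev]
      nlinarith
    -- Half of e in the exponent absorbs the factor e at the price 4ν; the other half supplies the
    -- Gaussian.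
    have h6 : kernelConj F ψ ν y x * e ≤ 4 * ν * gaussian (c / 24) ν (y - x) := by
      have h7 : kernelConj F ψ ν y x
          ≤ Real.exp (-(e / 2 / (2 * ν))) * gaussian (c / 12 / 2) ν (y - x) :=
        kernelConj_le_gaussian hν (by rw [← he]; linarith)
      have h8 : e * Real.exp (-(e / 2 / (2 * ν))) ≤ 4 * ν := by
        have h9 := Real.add_one_le_exp (e / (4 * ν))
        rw [show e / 2 / (2 * ν) = e / (4 * ν) by field_simp; ring, Real.exp_neg]
        rw [mul_inv_le_iff₀ (Real.exp_pos _)]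
        calc e = 4 * ν * (e / (4 * ν)) := by field_simp
          _ ≤ _ := by gcongr; linarith
      rw [show c / 24 = c / 12 / 2 by ring] at hG ⊢
      calc _ ≤ Real.exp (-(e / 2 / (2 * ν))) * gaussian (c / 12 / 2) ν (y - x) * e := by gcongr
        _ = e * Real.exp (-(e / 2 / (2 * ν))) * gaussian (c / 12 / 2) ν (y - x) := by ring
        _ ≤ _ := by gcongr
    calc q * ψ y ≤ q * ((1 - c / 2) * ψ x + e) := by gcongr
      _ = (1 - c / 2) * ψ x * q + q * e := by ring
      _ ≤ (1 - c / 2) * ψ x * q + D * kernelConj F ψ ν y x * e := by gcongr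
      _ = (1 - c / 2) * ψ x * q + D * (kernelConj F ψ ν y x * e) := by ring
      _ ≤ (1 - c / 2) * ψ x * q + D * (4 * ν * gaussian (c / 24) ν (y - x)) := by gcongr
      _ = _ := by ring

end Coercive

end IsWeakKAM

end KickedHJ

/-! ### Drift and minorization. -/

namespace KickedHJ

open Filter Topology

variable {d : ℕ}

theorem measurable_lyapunov {ψ : EuclideanSpace ℝ (Fin d) → ℝ} (hψ : Continuous ψ)
    {U : Set (EuclideanSpace ℝ (Fin d))} (hU : IsOpen U) (ν : ℝ) :
    Measurable (lyapunov ψ U ν) :=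
  hψ.measurable.mul ((measurable_chi hU ν).pow_const 2)

namespace IsWeakKAM

variable {F ψ : EuclideanSpace ℝ (Fin d) → ℝ} (hψ : IsWeakKAM F ψ) (hF : IsKickPotential F)
include hψ hF

theorem lyapunov_nonneg (U : Set (EuclideanSpace ℝ (Fin d))) (ν : ℝ)
    (x : EuclideanSpace ℝ (Fin d)) : 0 ≤ lyapunov ψ U ν x :=
  mul_nonneg (hψ.nonneg hF x) (sq_nonneg _)

theorem le_lyapunov (U : Set (EuclideanSpace ℝ (Fin d))) {ν : ℝ} (hν : 0 < ν) (hν1 : ν ≤ 1)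
    (x : EuclideanSpace ℝ (Fin d)) : ψ x ≤ lyapunov ψ U ν x :=
  le_mul_of_one_le_right (hψ.nonneg hF x) (one_le_pow₀ (one_le_chi U hν hν1 x))

omit hF in
theorem bddAbove_lyapunov (U : Set (EuclideanSpace ℝ (Fin d))) {ν : ℝ} (hν : 0 < ν)
    (hν1 : ν ≤ 1) : BddAbove (Set.range (lyapunov ψ U ν)) := by
  obtain ⟨M, hM0, hM⟩ := hψ.periodic.exists_le hψ.continuous
  refine ⟨M * (ν ^ (-((d : ℝ) / 2))) ^ 2, ?_⟩
  rintro _ ⟨x, rfl⟩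
  have h1 : 0 ≤ chi U ν x := zero_le_one.trans (one_le_chi U hν hν1 x)
  exact mul_le_mul (hM x) (pow_le_pow_left₀ h1 (chi_le U hν hν1 x) 2) (sq_nonneg _) hM0

theorem integrable_mul_lyapunov {U : Set (EuclideanSpace ℝ (Fin d))} (hU : IsOpen U) {ν : ℝ}
    (hν : 0 < ν) (hν1 : ν ≤ 1) {q : EuclideanSpace ℝ (Fin d) → ℝ} (hq : Integrable q) :
    Integrable fun y => q y * lyapunov ψ U ν y := by
  obtain ⟨B, hB⟩ := hψ.bddAbove_lyapunov U hν hν1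
  refine hq.mul_bdd (c := B) (measurable_lyapunov hψ.continuous hU ν).aestronglyMeasurable
    (Eventually.of_forall fun y => ?_)
  rw [Real.norm_of_nonneg (hψ.lyapunov_nonneg hF U ν y)]
  exact hB ⟨y, rfl⟩

/-- Off `U` the conjugated kernel is so small that it absorbs the powers of `χ_ν`. -/
theorem exists_mul_lyapunov_le {U : Set (EuclideanSpace ℝ (Fin d))} (hU : IsOpen U)
    (hper : ∀ (k : Fin d → ℤ) (x : EuclideanSpace ℝ (Fin d)), x + intVec k ∈ U ↔ x ∈ U)
    (hsub : backwardSet F ψ ⊆ U) : ∃ M b ν₁ : ℝ, 0 ≤ M ∧ 0 < b ∧ 0 < ν₁ ∧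
      ∀ ν, 0 < ν → ν < ν₁ → ∀ y ∉ U, ∀ x, chi U ν y * kernelConj F ψ ν y x * lyapunov ψ U ν y
        ≤ M * ν * gaussian b ν (y - x) := by
  obtain ⟨M, hM0, hM⟩ := hψ.periodic.exists_le hψ.continuous
  obtain ⟨a, ha, haE⟩ := hψ.exists_le_excess hF hU hper hsub
  obtain ⟨ν₁, hν₁, hexp⟩ := eventually_chi_pow_mul_exp_le ((d : ℝ) / 2) (a := a / 4)
    (by positivity)
  refine ⟨M, a / (2 * (a + M)) / 2 / 2, ν₁, hM0, by positivity, hν₁, fun ν hν hνν₁ y hy x => ?_⟩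
  have hE : a / 2 + a / (2 * (a + M)) / 2 * ‖y - x‖ ^ 2 ≤ excess F ψ y x := by
    have h1 := haE y hy x
    have h2 : ‖y - x‖ ^ 2 / 2 - M ≤ excess F ψ y x := by
      have := hM x
      have := hψ.nonneg hF y
      have := hF.nonneg y
      rw [excess, genFun, norm_sub_rev]
      linarith
    -- Weights 1 - t and t on the two lower bounds leave the constant a - t(a + M) = a/2 and a
    -- positive quadratic term.
    set t := a / (2 * (a + M)) with ht
    have ht0 : 0 ≤ t := by positivity
    have ht1 : t ≤ 1 := by
      rw [ht, div_le_one (by positivity)]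
      linarith
    have ht2 : t * (a + M) = a / 2 := by
      rw [ht]
      field_simp
    nlinarith [mul_le_mul_of_nonneg_left h2 ht0,
      mul_le_mul_of_nonneg_left h1 (sub_nonneg.2 ht1)]
  have hK := kernelConj_le_gaussian hν hE
  have hG := gaussian_nonneg (b := a / (2 * (a + M)) / 2 / 2) hν (y - x)
  have hchi : chi U ν y = ν ^ (-((d : ℝ) / 2)) := if_neg hy
  have h3 := hexp ν hν hνν₁
  rw [show a / 4 / ν = a / 2 / (2 * ν) by field_simp; ring, ← hchi] at h3
  have hchi0 : 0 ≤ chi U ν y := by rw [hchi]; positivity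
  have hψ0 := hψ.nonneg hF y
  calc chi U ν y * kernelConj F ψ ν y x * lyapunov ψ U ν y
      = ψ y * chi U ν y ^ 3 * kernelConj F ψ ν y x := by rw [lyapunov]; ring
    _ ≤ ψ y * chi U ν y ^ 3 * (Real.exp (-(a / 2 / (2 * ν)))
          * gaussian (a / (2 * (a + M)) / 2 / 2) ν (y - x)) := by gcongr
    _ = ψ y * (chi U ν y ^ 3 * Real.exp (-(a / 2 / (2 * ν))))
          * gaussian (a / (2 * (a + M)) / 2 / 2) ν (y - x) := by ring
    _ ≤ M * ν * gaussian (a / (2 * (a + M)) / 2 / 2) ν (y - x) := by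
        gcongr
        exact hM y

/-- The drift condition for the Lyapunov function. -/
theorem exists_markovOp_lyapunov_le {c : ℝ} (hc : 0 < c) (hc2 : c ≤ 1 / 2)
    (hcF : ∀ y, ∃ k, c * ‖y - intVec k‖ ^ 2 ≤ F y)
    {U : Set (EuclideanSpace ℝ (Fin d))} (hU : IsOpen U)
    (hper : ∀ (k : Fin d → ℤ) (x : EuclideanSpace ℝ (Fin d)), x + intVec k ∈ U ↔ x ∈ U)
    (hsub : backwardSet F ψ ⊆ U) {D : ℝ} (hD : 0 ≤ D) : ∃ C ν₁ : ℝ, 0 < ν₁ ∧ ν₁ ≤ 1 ∧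
      ∀ ν, 0 < ν → ν < ν₁ → ∀ p, IsPeriodicMarkovKernel p →
        (∀ y x, p y x ≤ D * chi U ν y * kernelConj F ψ ν y x) →
        ∀ x, markovOp p (lyapunov ψ U ν) x ≤ (1 - c / 2) * lyapunov ψ U ν x + C * ν := by
  obtain ⟨M, b, ν₁, hM, hb, hν₁, hoff⟩ := hψ.exists_mul_lyapunov_le hF hU hper hsub
  refine ⟨4 * D * (4 * (c / 24)) ^ (-((d : ℝ) / 2)) + D * M * (4 * b) ^ (-((d : ℝ) / 2)),
    min ν₁ 1, by positivity, min_le_right _ _, fun ν hν hνν p hp hpK x => ?_⟩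
  have hν1 : ν ≤ 1 := (hνν.trans_le (min_le_right _ _)).le
  have hgi : ∀ {b : ℝ}, 0 < b → Integrable fun y => gaussian b ν (y - x) := fun hb =>
    (integrable_gaussian hb hν).comp_sub_right x
  have hgv : ∀ {b : ℝ}, 0 < b → ∫ y, gaussian b ν (y - x) = (4 * b) ^ (-((d : ℝ) / 2)) :=
    fun hb => by rw [integral_sub_right_eq_self (gaussian _ ν), integral_gaussian hb hν]
  have hpt : ∀ y, p y x * lyapunov ψ U ν y ≤ (1 - c / 2) * ψ x * p y x
      + 4 * D * ν * gaussian (c / 24) ν (y - x) + D * M * ν * gaussian b ν (y - x) := fun y => by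
    have hg1 := gaussian_nonneg (b := c / 24) hν (y - x)
    have hg2 := gaussian_nonneg (b := b) hν (y - x)
    have hp0 := hp.nonneg y x
    have hψx := hψ.nonneg hF x
    by_cases hy : y ∈ U
    · have hchi : chi U ν y = 1 := if_pos hy
      have h := hpK y x
      rw [hchi, mul_one] at h
      rw [lyapunov, hchi, one_pow, mul_one]
      exact (hψ.mul_le_add_gaussian hc hc2 hcF hF hν hD y x hp0 h).trans
        (le_add_of_nonneg_right (by positivity))
    · have hV := hψ.lyapunov_nonneg hF U ν y
      have hc1 : 0 ≤ 1 - c / 2 := by linarith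
      calc p y x * lyapunov ψ U ν y
          ≤ D * chi U ν y * kernelConj F ψ ν y x * lyapunov ψ U ν y := by
            gcongr
            exact hpK y x
        _ = D * (chi U ν y * kernelConj F ψ ν y x * lyapunov ψ U ν y) := by ring
        _ ≤ D * (M * ν * gaussian b ν (y - x)) := by
            exact mul_le_mul_of_nonneg_left
              (hoff ν hν (hνν.trans_le (min_le_left _ _)) y hy x) hD
        _ = D * M * ν * gaussian b ν (y - x) := by ring
        _ ≤ _ := le_add_of_nonneg_left (by positivity)
  have hi1 := (hp.integrable x).const_mul ((1 - c / 2) * ψ x)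
  have hi2 := (hgi (b := c / 24) (by positivity)).const_mul (4 * D * ν)
  have hi3 := (hgi hb).const_mul (D * M * ν)
  have hi12 : Integrable fun y => (1 - c / 2) * ψ x * p y x
      + 4 * D * ν * gaussian (c / 24) ν (y - x) := hi1.add hi2
  calc markovOp p (lyapunov ψ U ν) x
      ≤ ∫ y, ((1 - c / 2) * ψ x * p y x + 4 * D * ν * gaussian (c / 24) ν (y - x)
          + D * M * ν * gaussian b ν (y - x)) :=
        integral_mono (hψ.integrable_mul_lyapunov hF hU hν hν1 (hp.integrable x))
          (hi12.add hi3) hpt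
    _ = (1 - c / 2) * ψ x + (4 * D * (4 * (c / 24)) ^ (-((d : ℝ) / 2))
          + D * M * (4 * b) ^ (-((d : ℝ) / 2))) * ν := by
        rw [integral_add hi12 hi3, integral_add hi1 hi2, integral_const_mul,
          integral_const_mul, integral_const_mul, hp.integral_eq_one, hgv (by positivity), hgv hb]
        ring
    _ ≤ _ := by
        gcongr
        · linarith
        · exact hψ.le_lyapunov hF U hν hν1 x

/-- The minorization condition on the sublevel sets of the Lyapunov function. -/
theorem exists_gaussian_le {U : Set (EuclideanSpace ℝ (Fin d))} (hU : IsOpen U)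
    (hsub : backwardSet F ψ ⊆ U) {D R : ℝ} (hD : 0 < D) (hR : 0 < R) :
    ∃ β b ν₁ : ℝ, 0 < β ∧ 0 < b ∧ 0 < ν₁ ∧ ν₁ ≤ 1 ∧
      ∀ ν, 0 < ν → ν < ν₁ → ∀ p, IsPeriodicMarkovKernel p →
        (∀ y x, kernelConj F ψ ν y x / (D * chi U ν x) ≤ p y x) →
        ∀ x, lyapunov ψ U ν x ≤ R * ν → ∀ k, x - intVec k ∈ unitCell d →
          ∀ y, β * gaussian b ν (y - intVec k) ≤ p y x := by
  obtain ⟨c, hc, hc2, hcF⟩ := hF.exists_mul_norm_sq_le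
  obtain ⟨B, hB0, hB⟩ := hF.exists_le_mul_norm_sq
  obtain ⟨r, hr, hrU⟩ := Metric.isOpen_iff.1 hU 0 (hsub (hψ.zero_mem_backwardSet hF))
  -- The excess is at most 2Rν/c + (3/2 + B)|y|² after translation by k; dividing by 2ν gives R/c
  -- and the Gaussian rate. The bound on ν places x in the r-ball inside U.
  refine ⟨Real.exp (-(R / c)) / D, (3 / 2 + B) / 2, min 1 (c / 2 * r ^ 2 / R), by positivity,
    by positivity, by positivity, min_le_left _ _, fun ν hν hνν p hp hpK x hx k hk y => ?_⟩
  have hν1 : ν ≤ 1 := (hνν.trans_le (min_le_left _ _)).le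
  have hνr : R * ν < c / 2 * r ^ 2 := by
    rw [mul_comm]
    exact (lt_div_iff₀ hR).1 (hνν.trans_le (min_le_right _ _))
  have hψx : ψ (x - intVec k) ≤ R * ν := by
    rw [hψ.periodic.sub]
    exact (hψ.le_lyapunov hF U hν hν1 x).trans hx
  have hxk := hψ.mul_norm_sq_le hc hc2 hcF hF (unitCell_subset_closedCell hk)
  have hxU : x - intVec k ∈ U := hrU (by
    rw [mem_ball_zero_iff]
    refine lt_of_pow_lt_pow_left₀ 2 hr.le ?_
    nlinarith)
  have hpyx : p (y - intVec k) (x - intVec k) = p y x := by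
    rw [← hp.periodic k, sub_add_cancel, sub_add_cancel]
  rw [← hpyx]
  generalize x - intVec k = x at *
  generalize y - intVec k = y at *
  have hchi : chi U ν x = 1 := if_pos hxU
  have hE : excess F ψ y x ≤ 2 * R * ν / c + (3 / 2 + B) * ‖y‖ ^ 2 := by
    have h1 : ‖x‖ ^ 2 ≤ 2 * R * ν / c := by
      rw [le_div_iff₀ hc]
      nlinarith
    have h2 : ‖x - y‖ ^ 2 ≤ 2 * ‖x‖ ^ 2 + 2 * ‖y‖ ^ 2 := by
      nlinarith [norm_sub_le x y, norm_nonneg (x - y), sq_nonneg (‖x‖ - ‖y‖)]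
    have h3 := hψ.le_half_norm_sq hF 0 y
    have h0 : intVec (0 : Fin d → ℤ) = 0 := by ext; simp [intVec]
    rw [h0, sub_zero] at h3
    have h4 := hB y
    have h5 := hψ.nonneg hF x
    rw [excess, genFun]
    linarith
  refine le_trans ?_ (hpK y x)
  rw [hchi, mul_one, kernelConj_eq, gaussian, div_mul_eq_mul_div, mul_left_comm, ← Real.exp_add]
  gcongr
  rw [show -(R / c) + -((3 / 2 + B) / 2 / ν) * ‖y‖ ^ 2
    = -((2 * R * ν / c + (3 / 2 + B) * ‖y‖ ^ 2) / (2 * ν)) by field_simp; ring]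
  gcongr

end IsWeakKAM

theorem isProbDensity_gaussian {b ν : ℝ} (hb : 0 < b) (hν : 0 < ν) :
    IsProbDensity fun y : EuclideanSpace ℝ (Fin d) =>
      ((4 * b) ^ (-((d : ℝ) / 2)))⁻¹ * gaussian b ν y where
  measurable := (measurable_gaussian b ν).const_mul _
  nonneg y := mul_nonneg (by positivity) (gaussian_nonneg hν y)
  integrable := (integrable_gaussian hb hν).const_mul _
  integral_eq_one := by
    rw [integral_const_mul, integral_gaussian hb hν]
    exact inv_mul_cancel₀ (by positivity)

end KickedHJ

/-! ### Choice of the constants. -/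

theorem mainTheorem6 {d : ℕ} (F ψ : EuclideanSpace ℝ (Fin d) → ℝ)
    (hF : IsKickPotential F) (hψ : IsWeakKAM F ψ) :
    ∃ γ : ℝ, 0 < γ ∧ γ < 1 ∧
      ∀ U : Set (EuclideanSpace ℝ (Fin d)), IsOpen U →
        (∀ (k : Fin d → ℤ) (x : EuclideanSpace ℝ (Fin d)), x + intVec k ∈ U ↔ x ∈ U) →
        backwardSet F ψ ⊆ U →
      ∀ D : ℝ, 1 < D →
        ∃ (C α₀ ν₁ R : ℝ) (g : ℝ → EuclideanSpace ℝ (Fin d) → ℝ),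
          1 < C ∧ 0 < α₀ ∧ α₀ < 1 ∧ 0 < ν₁ ∧ 2 * C / (1 - γ) < R ∧
          (∀ ν : ℝ, 0 < ν → ν < ν₁ → IsProbDensity (g ν)) ∧
          ∀ (ν₀ : ℝ) (p : ℝ → EuclideanSpace ℝ (Fin d) → EuclideanSpace ℝ (Fin d) → ℝ),
            0 < ν₀ →
            (∀ ν : ℝ, 0 < ν → ν < ν₀ → IsPeriodicMarkovKernel (p ν)) →
            (∀ ν : ℝ, 0 < ν → ν < ν₀ → ∀ y x : EuclideanSpace ℝ (Fin d),
              1 / (D * chi U ν x) ≤ p ν y x / kernelConj F ψ ν y x ∧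
              p ν y x / kernelConj F ψ ν y x ≤ D * chi U ν y) →
            ∀ ν : ℝ, 0 < ν → ν < ν₀ → ν < ν₁ →
              ((∀ x, 0 ≤ lyapunov ψ U ν x) ∧ BddAbove (Set.range (lyapunov ψ U ν)) ∧
                ∀ x, Integrable (fun y => p ν y x * lyapunov ψ U ν y) ∧
                  markovOp (p ν) (lyapunov ψ U ν) x ≤ γ * lyapunov ψ U ν x + C * ν) ∧
              (∀ x, lyapunov ψ U ν x ≤ R * ν →
                ∀ k : Fin d → ℤ, x - intVec k ∈ unitCell d →
                  ∀ y, α₀ * g ν (y - intVec k) ≤ p ν y x) := by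
  obtain ⟨c, hc, hc2, hcF⟩ := hF.exists_mul_norm_sq_le
  refine ⟨1 - c / 2, by linarith, by linarith, fun U hU hper hsub D hD => ?_⟩
  have hD0 : 0 < D := one_pos.trans hD
  obtain ⟨C, ν₁, hν₁, hν₁1, hdrift⟩ :=
    hψ.exists_markovOp_lyapunov_le hF hc hc2 hcF hU hper hsub hD0.le
  have hC2 : 0 < max C 2 := by positivity
  have hR0 : 0 < 2 * max C 2 / (1 - (1 - c / 2)) + 1 := by
    have : 0 < 1 - (1 - c / 2) := by linarith
    positivity
  obtain ⟨β, b, ν₂, hβ, hb, hν₂, hν₂1, hminor⟩ :=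
    hψ.exists_gaussian_le hF hU hsub hD0 hR0
  -- The maximum with 2 ensures C > 1. Normalizing the Gaussian to a density moves its mass into α₀,
  -- and the minimum with 1/2 keeps α₀ < 1.
  refine ⟨max C 2, min (1 / 2) (β * (4 * b) ^ (-((d : ℝ) / 2))), min ν₁ ν₂,
    2 * max C 2 / (1 - (1 - c / 2)) + 1,
    fun ν y => ((4 * b) ^ (-((d : ℝ) / 2)))⁻¹ * gaussian b ν y,
    lt_max_of_lt_right one_lt_two, by positivity,
    (min_le_left _ _).trans_lt one_half_lt_one, by positivity, lt_add_one _,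
    fun ν hν _ => isProbDensity_gaussian hb hν, fun ν₀ p _ hp hpK ν hν hνν₀ hνν => ?_⟩
  have hν1 : ν < ν₁ := hνν.trans_le (min_le_left _ _)
  have hν2 : ν < ν₂ := hνν.trans_le (min_le_right _ _)
  have hle : ν ≤ 1 := hν1.le.trans hν₁1
  have hup : ∀ y x, p ν y x ≤ D * chi U ν y * kernelConj F ψ ν y x := fun y x =>
    (div_le_iff₀ (kernelConj_pos F ψ hν y x)).1 (hpK ν hν hνν₀ y x).2
  have hlow : ∀ y x, kernelConj F ψ ν y x / (D * chi U ν x) ≤ p ν y x := fun y x => by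
    have h := (le_div_iff₀ (kernelConj_pos F ψ hν y x)).1 (hpK ν hν hνν₀ y x).1
    rwa [one_div_mul_eq_div] at h
  refine ⟨⟨hψ.lyapunov_nonneg hF U ν, hψ.bddAbove_lyapunov U hν hle, fun x =>
    ⟨hψ.integrable_mul_lyapunov hF hU hν hle ((hp ν hν hνν₀).integrable x), ?_⟩⟩,
    fun x hx k hk y => ?_⟩
  · refine (hdrift ν hν hν1 (p ν) (hp ν hν hνν₀) hup x).trans ?_
    gcongr
    exact le_max_left _ _
  · refine le_trans ?_ (hminor ν hν hν2 (p ν) (hp ν hν hνν₀) hlow x hx k hk y)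
    have hpos : 0 < (4 * b) ^ (-((d : ℝ) / 2)) := by positivity
    have hG := gaussian_nonneg (b := b) hν (y - intVec k)
    calc _ ≤ β * (4 * b) ^ (-((d : ℝ) / 2)) *
          (((4 * b) ^ (-((d : ℝ) / 2)))⁻¹ * gaussian b ν (y - intVec k)) := by
          gcongr
          exact min_le_right _ _
      _ = β * gaussian b ν (y - intVec k) := by field_simp
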